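/- Let $\mathbb{F}$ be an infinite field of arbitrary characteristic, and let $\mathbb{F}\langle X\rangle$ be the free unital associative $\mathbb{F}$-algebra on the countable set of letters $X=\{x_1,x_2,\dots\}$. Let $\mathsf{A}_1=\mathbb{F}\langle x,y\rangle/\langle yx-xy-1\rangle$ be the Weyl algebra and let $\mathsf{V}\subset \mathsf{A}_1$ be the $\mathbb{F}$-linear span of $x$ and $y$. A weak polynomial identity for the pair $(\mathsf{A}_1,\mathsf{V})$ is an element $f=f(x_1,\dots,x_m)\in\mathbb{F}\langle X\rangle$ such that $f(a_1,\dots,a_m)=0$ in $\mathsf{A}_1$ for all $a_1,\dots,a_m\in \mathsf{V}$. Writing $[a,b]=ab-ba$, put $$\Gamma_3(x_1,x_2,x_3)=[[x_1,x_2],x_3],\qquad \mathrm{St}_3(x_1,x_2,x_3)=x_1[x_2,x_3]-x_2[x_1,x_3]+x_3[x_1,x_2],$$ $$T_4(x_1,x_2,x_3,x_4)=[x_1,x_2][x_3,x_4]-[x_1,x_3][x_2,x_4]+[x_2,x_3][x_1,x_4].$$ Let $\mathcal{I}$ be the L-ideal of $\mathbb{F}\langle X\rangle$ generated by $\Gamma_3$,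 $\mathrm{St}_3$ and $T_4$, that is, the $\mathbb{F}$-linear span of all elements $u\,h(g_1,\dots,g_m)\,v$ with $h\in\{\Gamma_3,\mathrm{St}_3,T_4\}$ (and $m=3$, $3$, $4$ respectively), $u,v\in\mathbb{F}\langle X\rangle$, and $g_1,\dots,g_m$ linear combinations of letters. Then every weak polynomial identity $f$ for $(\mathsf{A}_1,\mathsf{V})$ of (total) degree $4$ (not necessarily homogeneous) lies in $\mathcal{I}$. -/

import Mathlib

namespace WeakPI

noncomputable section

/-- The free unital associative algebra `F⟨X⟩` on the countable set of letters
`X = {x 0, x 1, x 2, …}`. -/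
abbrev FreeAlg (F : Type*) [Field F] := FreeAlgebra F ℕ

/-- The letters of `F⟨X⟩`. -/
def x (F : Type*) [Field F] (i : ℕ) : FreeAlg F := FreeAlgebra.ι F i

/-- The (total) degree of a noncommutative polynomial: the largest length of a monomial that
occurs in it with nonzero coefficient (and `0` for the zero polynomial). -/
def degree {F : Type*} [Field F] (f : FreeAlg F) : ℕ :=
  (FreeAlgebra.equivMonoidAlgebraFreeMonoid f : MonoidAlgebra F (FreeMonoid ℕ)).coeff.support.sup
    FreeMonoid.length

/-- Substitution `f(a 0, a 1, …)` of elements of an algebra for the letters. -/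
def subst {F : Type*} [Field F] {A : Type*} [Ring A] [Algebra F A] (a : ℕ → A) (f : FreeAlg F) :
    A :=
  FreeAlgebra.lift F a f

/-- `f` is a polynomial identity for the subspace `V` of the algebra `A`: it vanishes under all
substitutions of elements of `V`. When `V` generates `A`, these are the weak polynomial identities
for the pair `(A, V)`. -/
def IsWeakIdentity {F : Type*} [Field F] {A : Type*} [Ring A] [Algebra F A] (V : Submodule F A)
    (f : FreeAlg F) : Prop :=
  ∀ a : ℕ → A, (∀ i, a i ∈ V) → subst a f = 0

/-- The defining relation `y x = x y + 1` of the Weyl algebra, where `x` and `y` are the free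
generators with index `0` and `1`. -/
inductive WeylRel (F : Type*) [Field F] : FreeAlgebra F (Fin 2) → FreeAlgebra F (Fin 2) → Prop
  | yx : WeylRel F (FreeAlgebra.ι F 1 * FreeAlgebra.ι F 0)
      (FreeAlgebra.ι F 0 * FreeAlgebra.ι F 1 + 1)

/-- The Weyl algebra `A₁ = F⟨x, y⟩ / ⟨y x - x y - 1⟩`. -/
abbrev WeylAlgebra (F : Type*) [Field F] := RingQuot (WeylRel F)

/-- The generator `x` of the Weyl algebra. -/
def weylX (F : Type*) [Field F] : WeylAlgebra F :=
  RingQuot.mkAlgHom F (WeylRel F) (FreeAlgebra.ι F 0)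

/-- The generator `y` of the Weyl algebra. -/
def weylY (F : Type*) [Field F] : WeylAlgebra F :=
  RingQuot.mkAlgHom F (WeylRel F) (FreeAlgebra.ι F 1)

/-- The subspace `V = span {x, y}` of the Weyl algebra. -/
def weylV (F : Type*) [Field F] : Submodule F (WeylAlgebra F) :=
  Submodule.span F {weylX F, weylY F}

/-- The L-ideal of `F⟨X⟩` generated by a set `S`: the linear span of all `u * f(g 0, g 1, …) * v`
with `f ∈ S`, `u, v ∈ F⟨X⟩` and `g 0, g 1, …` linear combinations of letters. -/
def lIdeal {F : Type*} [Field F] (S : Set (FreeAlg F)) : Submodule F (FreeAlg F) :=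
  Submodule.span F {h | ∃ f ∈ S, ∃ g : ℕ → FreeAlg F,
    (∀ i, g i ∈ Submodule.span F (Set.range (x F))) ∧ ∃ u v : FreeAlg F, h = u * subst g f * v}

/-- `Γ₃(x₁, x₂, x₃) = [[x₁, x₂], x₃]`, where `⁅a, b⁆ = a * b - b * a`. -/
def Gamma3 (F : Type*) [Field F] : FreeAlg F := ⁅⁅x F 1, x F 2⁆, x F 3⁆

/-- `St₃(x₁, x₂, x₃) = x₁ [x₂, x₃] - x₂ [x₁, x₃] + x₃ [x₁, x₂]`. -/
def St3 (F : Type*) [Field F] : FreeAlg F :=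
  x F 1 * ⁅x F 2, x F 3⁆ - x F 2 * ⁅x F 1, x F 3⁆ + x F 3 * ⁅x F 1, x F 2⁆

/-- `T₄(x₁, x₂, x₃, x₄) = [x₁, x₂][x₃, x₄] - [x₁, x₃][x₂, x₄] + [x₂, x₃][x₁, x₄]`. -/
def T4 (F : Type*) [Field F] : FreeAlg F :=
  ⁅x F 1, x F 2⁆ * ⁅x F 3, x F 4⁆ - ⁅x F 1, x F 3⁆ * ⁅x F 2, x F 4⁆
    + ⁅x F 2, x F 3⁆ * ⁅x F 1, x F 4⁆

end

end WeakPI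

/-!
Give the letter `x i` the index `i + 1`, add an index `0`, and put `[i+1|0] = x i`,
`[i+1|j+1] = [x i, x j]`, `[0|0] = 1`. Then `Γ₃`, `St₃` and `T₄` say that commutators of letters
are central and that these symbols satisfy the exchange relation
`[i|j][k|l] = [k|j][i|l] + [i|k][j|l]` of `2 × 2` minors. Hence, modulo the L-ideal, a product
`∏ [i|j]` with all `j < i` depends only on the multisets of the `i` and of the `j`, up to products
with a smaller sum of the `i`.

The generic elements of `V`, represented on polynomials by `y ↦ b 0`, `x ↦ -∂/∂(b 0)` and applied
to `1`, send such a product to `∏ a i * b j` plus terms of smaller weight, where `a i` has weight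
`i` and `b j` has weight `0`. The leading monomial determines both multisets, so subtracting the
products that it prescribes lowers the weight; for a weak identity there is nothing to subtract,
and the weight descends to `0`.
-/

namespace WeakPI

variable {F : Type*} [Field F]

section LIdeal

variable {S : Set (FreeAlg F)} {f : FreeAlg F}

theorem mul_mem_lIdeal_left (r : FreeAlg F) (hf : f ∈ lIdeal S) : r * f ∈ lIdeal S := by
  induction hf using Submodule.span_induction with
  | zero => simp
  | add f g _ _ hf hg => simpa only [mul_add] using add_mem hf hg
  | smul c f _ hf => simpa only [mul_smul_comm] using Submodule.smul_mem _ c hf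
  | mem f hf =>
    obtain ⟨h, hh, g, hg, u, v, rfl⟩ := hf
    exact Submodule.subset_span ⟨h, hh, g, hg, r * u, v, by simp only [mul_assoc]⟩

theorem mul_mem_lIdeal_right (r : FreeAlg F) (hf : f ∈ lIdeal S) : f * r ∈ lIdeal S := by
  induction hf using Submodule.span_induction with
  | zero => simp
  | add f g _ _ hf hg => simpa only [add_mul] using add_mem hf hg
  | smul c f _ hf => simpa only [smul_mul_assoc] using Submodule.smul_mem _ c hf
  | mem f hf =>
    obtain ⟨h, hh, g, hg, u, v, rfl⟩ := hf
    exact Submodule.subset_span ⟨h, hh, g, hg, u, v * r, by simp only [mul_assoc]⟩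

theorem subst_letters_mem_lIdeal (hf : f ∈ S) (n : ℕ → ℕ) :
    subst (fun i => x F (n i)) f ∈ lIdeal S :=
  Submodule.subset_span ⟨f, hf, fun i => x F (n i),
    fun i => Submodule.subset_span ⟨n i, rfl⟩, 1, 1, by simp⟩

end LIdeal

section Substitution

variable {A : Type*} [Ring A] [Algebra F A]

@[simp]
theorem subst_x (a : ℕ → A) (i : ℕ) : subst a (x F i) = a i := FreeAlgebra.lift_ι_apply a i

theorem subst_add (a : ℕ → A) (f g : FreeAlg F) : subst a (f + g) = subst a f + subst a g :=
  map_add _ f g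

theorem subst_sub (a : ℕ → A) (f g : FreeAlg F) : subst a (f - g) = subst a f - subst a g :=
  map_sub _ f g

theorem subst_mul (a : ℕ → A) (f g : FreeAlg F) : subst a (f * g) = subst a f * subst a g :=
  map_mul _ f g

theorem subst_lie (a : ℕ → A) (f g : FreeAlg F) : subst a ⁅f, g⁆ = ⁅subst a f, subst a g⁆ := by
  simp only [Ring.lie_def, subst_sub, subst_mul]

theorem subst_Gamma3 (a : ℕ → A) : subst a (Gamma3 F) = ⁅⁅a 1, a 2⁆, a 3⁆ := by
  simp only [Gamma3, subst_lie, subst_x]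

theorem subst_St3 (a : ℕ → A) :
    subst a (St3 F) = a 1 * ⁅a 2, a 3⁆ - a 2 * ⁅a 1, a 3⁆ + a 3 * ⁅a 1, a 2⁆ := by
  simp only [St3, subst_add, subst_sub, subst_mul, subst_lie, subst_x]

theorem subst_T4 (a : ℕ → A) :
    subst a (T4 F) = ⁅a 1, a 2⁆ * ⁅a 3, a 4⁆ - ⁅a 1, a 3⁆ * ⁅a 2, a 4⁆
      + ⁅a 2, a 3⁆ * ⁅a 1, a 4⁆ := by
  simp only [T4, subst_add, subst_sub, subst_mul, subst_lie, subst_x]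

theorem subst_subst (a : ℕ → A) (g : ℕ → FreeAlg F) (f : FreeAlg F) :
    subst a (subst g f) = subst (fun i => subst a (g i)) f := by
  have h : (FreeAlgebra.lift F a).comp (FreeAlgebra.lift F g)
      = FreeAlgebra.lift F fun i => FreeAlgebra.lift F a (g i) := by
    ext i
    simp
  exact DFunLike.congr_fun h f

end Substitution

section WeakIdentities

theorem isWeakIdentity_of_mem_lIdeal {A : Type*} [Ring A] [Algebra F A] {V : Submodule F A}
    {S : Set (FreeAlg F)} (hS : ∀ f ∈ S, IsWeakIdentity V f) {f : FreeAlg F}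
    (hf : f ∈ lIdeal S) : IsWeakIdentity V f := by
  intro a ha
  suffices hle : lIdeal S ≤ LinearMap.ker (FreeAlgebra.lift F a).toLinearMap from hle hf
  refine Submodule.span_le.2 ?_
  rintro _ ⟨h, hh, g, hg, u, v, rfl⟩
  have hgV (i : ℕ) : subst a (g i) ∈ V := by
    suffices hle : Submodule.span F (Set.range (x F)) ≤
        V.comap (FreeAlgebra.lift F a).toLinearMap from hle (hg i)
    refine Submodule.span_le.2 ?_
    rintro _ ⟨j, rfl⟩
    simpa [x] using ha j
  have h0 : FreeAlgebra.lift F a (subst g h) = 0 :=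
    (subst_subst a g h).trans (hS h hh _ hgV)
  simp [h0]

variable {A : Type*} [Ring A] {X Y : A}

theorem lie_of_weyl {R : Type*} [CommRing R] [Algebra R A] (h : Y * X = X * Y + 1)
    (p q p' q' : R) :
    ⁅p • X + q • Y, p' • X + q' • Y⁆ = algebraMap R A (q * p' - p * q') := by
  rw [Ring.lie_def, Algebra.algebraMap_eq_smul_one]
  simp only [add_mul, mul_add, smul_mul_smul_comm, h]
  module

theorem isWeakIdentity_of_weyl [Algebra F A] (h : Y * X = X * Y + 1) {f : FreeAlg F}
    (hf : f ∈ ({Gamma3 F, St3 F, T4 F} : Set (FreeAlg F))) :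
    IsWeakIdentity (Submodule.span F {X, Y}) f := by
  intro v hv
  choose p q hv using fun i => Submodule.mem_span_pair.1 (hv i)
  have hlie (i j : ℕ) : ⁅v i, v j⁆ = algebraMap F A (q i * p j - p i * q j) := by
    rw [← hv, ← hv, lie_of_weyl h]
  rcases hf with rfl | rfl | rfl
  · rw [subst_Gamma3, hlie, Ring.lie_def, Algebra.commutes, sub_self]
  · simp only [subst_St3, hlie, ← Algebra.commutes, ← Algebra.smul_def]
    simp only [← hv]
    module
  · simp only [subst_T4, hlie, ← map_mul, ← map_sub, ← map_add]
    rw [← map_zero (algebraMap F A)]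
    congr 1
    ring

theorem weylY_mul_weylX : weylY F * weylX F = weylX F * weylY F + 1 := by
  simpa [weylX, weylY] using RingQuot.mkAlgHom_rel F (WeylRel.yx (F := F))

end WeakIdentities

section Minors

/-- The L-ideal generated by `Γ₃`, `St₃` and `T₄`. -/
def pluckerLIdeal (F : Type*) [Field F] : Submodule F (FreeAlg F) :=
  lIdeal {Gamma3 F, St3 F, T4 F}

/-- The noncommutative analogue `[i|j]` of the `2 × 2` minor `a i * b j - a j * b i`, where the
index `i + 1` belongs to the letter `x i` and `0` is an additional index: `[i+1|j+1]` is a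
commutator of letters and `[i+1|0]` is a letter. With this convention the relations `Γ₃`, `St₃`,
`T₄` become instances of the single relation `minor_exchange_mem_pluckerLIdeal`. -/
def minor (F : Type*) [Field F] : ℕ → ℕ → FreeAlg F
  | 0, 0 => 1
  | i + 1, 0 => x F i
  | 0, j + 1 => -x F j
  | i + 1, j + 1 => ⁅x F i, x F j⁆

theorem Gamma3_mem (i j k : ℕ) : ⁅⁅x F i, x F j⁆, x F k⁆ ∈ pluckerLIdeal F := by
  have h := subst_letters_mem_lIdeal (S := {Gamma3 F, St3 F, T4 F}) (f := Gamma3 F) (by simp)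
    fun t => [0, i, j, k].getD t 0
  rwa [subst_Gamma3] at h

theorem St3_mem (i j k : ℕ) :
    x F i * ⁅x F j, x F k⁆ - x F j * ⁅x F i, x F k⁆ + x F k * ⁅x F i, x F j⁆
      ∈ pluckerLIdeal F := by
  have h := subst_letters_mem_lIdeal (S := {Gamma3 F, St3 F, T4 F}) (f := St3 F) (by simp)
    fun t => [0, i, j, k].getD t 0
  rwa [subst_St3] at h

theorem T4_mem (i j k l : ℕ) :
    ⁅x F i, x F j⁆ * ⁅x F k, x F l⁆ - ⁅x F i, x F k⁆ * ⁅x F j, x F l⁆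
      + ⁅x F j, x F k⁆ * ⁅x F i, x F l⁆ ∈ pluckerLIdeal F := by
  have h := subst_letters_mem_lIdeal (S := {Gamma3 F, St3 F, T4 F}) (f := T4 F) (by simp)
    fun t => [0, i, j, k, l].getD t 0
  rwa [subst_T4] at h

theorem lie_lie_mem_pluckerLIdeal (i j : ℕ) (f : FreeAlg F) :
    ⁅⁅x F i, x F j⁆, f⁆ ∈ pluckerLIdeal F := by
  induction f using FreeAlgebra.induction with
  | grade0 r => simp [Ring.lie_def, Algebra.commutes]
  | grade1 k => exact Gamma3_mem i j k
  | add f g hf hg =>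
    simpa only [Ring.lie_def, mul_add, add_mul, add_sub_add_comm] using add_mem hf hg
  | mul f g hf hg =>
    have leibniz (c : FreeAlg F) : ⁅c, f * g⁆ = ⁅c, f⁆ * g + f * ⁅c, g⁆ := by
      simp only [Ring.lie_def]
      noncomm_ring
    rw [leibniz]
    exact add_mem (mul_mem_lIdeal_right g hf) (mul_mem_lIdeal_left f hg)

theorem minor_swap {i j : ℕ} (hij : i ≠ j) : minor F i j = -minor F j i := by
  match i, j with
  | 0, 0 => exact absurd rfl hij
  | i + 1, 0 => exact (neg_neg _).symm
  | 0, j + 1 => rfl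
  | i + 1, j + 1 => exact (neg_sub _ _).symm

theorem minor_succ_self (i : ℕ) : minor F (i + 1) (i + 1) = 0 := sub_self _

theorem minor_exchange_mem_pluckerLIdeal {i k : ℕ} (hi : 0 < i) (hk : 0 < k) (j l : ℕ) :
    minor F i j * minor F k l - minor F k j * minor F i l - minor F i k * minor F j l
      ∈ pluckerLIdeal F := by
  obtain ⟨i, rfl⟩ := Nat.exists_eq_succ_of_ne_zero hi.ne'
  obtain ⟨k, rfl⟩ := Nat.exists_eq_succ_of_ne_zero hk.ne'
  match j, l with
  | 0, 0 => simp [minor, Ring.lie_def]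
  | 0, l + 1 =>
    convert add_mem (St3_mem (F := F) i k l) (Gamma3_mem i k l) using 1
    simp only [minor, Ring.lie_def]
    noncomm_ring
  | j + 1, 0 =>
    convert add_mem (St3_mem (F := F) i j k)
      (sub_mem (sub_mem (Gamma3_mem i j k) (Gamma3_mem k j i)) (Gamma3_mem i k j)) using 1
    simp only [minor, Ring.lie_def]
    noncomm_ring
  | j + 1, l + 1 =>
    convert T4_mem (F := F) i j k l using 1
    simp only [minor, Ring.lie_def]
    noncomm_ring

theorem minor_mul_sub_minor_mul_mem {i j k l : ℕ} (hi : 0 < i) (hj : 0 < j) :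
    minor F i j * minor F k l - minor F k l * minor F i j ∈ pluckerLIdeal F := by
  obtain ⟨i, rfl⟩ := Nat.exists_eq_succ_of_ne_zero hi.ne'
  obtain ⟨j, rfl⟩ := Nat.exists_eq_succ_of_ne_zero hj.ne'
  exact lie_lie_mem_pluckerLIdeal i j (minor F k l)

end Minors

section Straightening

/-- A two-rowed tableau, given as the list of its columns `(i, j)`, where `i` is the entry of the
first row and `j < i` that of the second row. The order of the columns is arbitrary, so that
tableaux with the same rows (up to order) are to be compared. -/
def IsTableau (L : List (ℕ × ℕ)) : Prop := ∀ p ∈ L, p.2 < p.1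

/-- The product of the minors given by the columns of a tableau. -/
def minorProd (F : Type*) [Field F] (L : List (ℕ × ℕ)) : FreeAlg F :=
  (L.map fun p => minor F p.1 p.2).prod

/-- The weight of a tableau, the sum of the entries in its first row. Every correction term that
arises in straightening has smaller weight. -/
def topSum (L : List (ℕ × ℕ)) : ℕ := (L.map Prod.fst).sum

/-- The combinations of tableaux of weight less than `n`, modulo the L-ideal. -/
def lowerTerms (F : Type*) [Field F] (n : ℕ) : Submodule F (FreeAlg F) :=
  pluckerLIdeal F ⊔
    Submodule.span F {f | ∃ L, IsTableau L ∧ topSum L < n ∧ minorProd F L = f}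

@[simp]
theorem isTableau_cons {p : ℕ × ℕ} {L : List (ℕ × ℕ)} :
    IsTableau (p :: L) ↔ p.2 < p.1 ∧ IsTableau L := List.forall_mem_cons

theorem IsTableau.perm {L L' : List (ℕ × ℕ)} (hL : IsTableau L) (h : L.Perm L') :
    IsTableau L' := fun p hp => hL p (h.mem_iff.2 hp)

@[simp]
theorem minorProd_cons (p : ℕ × ℕ) (L : List (ℕ × ℕ)) :
    minorProd F (p :: L) = minor F p.1 p.2 * minorProd F L := by simp [minorProd]

@[simp]
theorem topSum_cons (p : ℕ × ℕ) (L : List (ℕ × ℕ)) : topSum (p :: L) = p.1 + topSum L := by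
  simp [topSum]

theorem lowerTerms_zero : lowerTerms F 0 = pluckerLIdeal F := by simp [lowerTerms]

theorem pluckerLIdeal_le_lowerTerms (n : ℕ) : pluckerLIdeal F ≤ lowerTerms F n := le_sup_left

theorem minorProd_mem_lowerTerms {L : List (ℕ × ℕ)} (hL : IsTableau L) {n : ℕ}
    (hn : topSum L < n) : minorProd F L ∈ lowerTerms F n :=
  Submodule.mem_sup_right (Submodule.subset_span ⟨L, hL, hn, rfl⟩)

theorem lowerTerms_mono : Monotone (lowerTerms F) := fun m n hmn => by
  refine sup_le_sup_left (Submodule.span_mono ?_) _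
  rintro _ ⟨L, hL, hm, rfl⟩
  exact ⟨L, hL, hm.trans_le hmn, rfl⟩

theorem lowerTerms_le {n : ℕ} {P : Submodule F (FreeAlg F)} (hI : pluckerLIdeal F ≤ P)
    (hL : ∀ L, IsTableau L → topSum L < n → minorProd F L ∈ P) : lowerTerms F n ≤ P :=
  sup_le hI (Submodule.span_le.2 fun _ ⟨L, hL', hn, h⟩ => h ▸ hL L hL' hn)

theorem minor_mul_mem_lowerTerms_of_lt {i j n : ℕ} (hji : j < i) {f : FreeAlg F}
    (hf : f ∈ lowerTerms F n) : minor F i j * f ∈ lowerTerms F (i + n) := by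
  suffices hle : lowerTerms F n ≤
      (lowerTerms F (i + n)).comap (LinearMap.mulLeft F (minor F i j)) from hle hf
  refine lowerTerms_le (fun g hg => ?_) fun L hL hn => ?_
  · exact pluckerLIdeal_le_lowerTerms _ (mul_mem_lIdeal_left _ hg)
  · rw [Submodule.mem_comap, LinearMap.mulLeft_apply, ← minorProd_cons (i, j)]
    exact minorProd_mem_lowerTerms (by simp [hji, hL]) (by simpa using hn)

theorem minor_mul_mem_lowerTerms (i j : ℕ) {n : ℕ} {f : FreeAlg F}
    (hf : f ∈ lowerTerms F n) : minor F i j * f ∈ lowerTerms F (max i j + n) := by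
  rcases lt_trichotomy j i with hji | rfl | hij
  · simpa [hji.le] using minor_mul_mem_lowerTerms_of_lt hji hf
  · cases j with
    | zero => simpa [minor] using hf
    | succ j => simp [minor_succ_self]
  · rw [minor_swap hij.ne, neg_mul]
    simpa [hij.le] using minor_mul_mem_lowerTerms_of_lt hij hf

theorem minorProd_exchange_tops_sub_mem {i j k l : ℕ} (hji : j < i) (hjk : j < k) (hli : l < i)
    (hlk : l < k) {R : List (ℕ × ℕ)} (hR : IsTableau R) :
    minorProd F ((i, j) :: (k, l) :: R) - minorProd F ((k, j) :: (i, l) :: R)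
      ∈ lowerTerms F (i + k + topSum R) := by
  have relation := pluckerLIdeal_le_lowerTerms (i + k + topSum R) (mul_mem_lIdeal_right
    (minorProd F R) (minor_exchange_mem_pluckerLIdeal (F := F) (pos_of_gt hji) (pos_of_gt hjk) j l))
  have correction : minor F i k * (minor F j l * minorProd F R) ∈ lowerTerms F (i + k + topSum R) :=
    lowerTerms_mono (by lia) (minor_mul_mem_lowerTerms i k (minor_mul_mem_lowerTerms j l
      (minorProd_mem_lowerTerms hR (Nat.lt_succ_self _))))
  convert add_mem relation correction using 1
  simp only [minorProd_cons]
  noncomm_ring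

theorem minorProd_swap_sub_mem {p q : ℕ × ℕ} {R : List (ℕ × ℕ)} (hL : IsTableau (p :: q :: R)) :
    minorProd F (p :: q :: R) - minorProd F (q :: p :: R)
      ∈ lowerTerms F (topSum (p :: q :: R)) := by
  obtain ⟨i, j⟩ := p
  obtain ⟨k, l⟩ := q
  simp only [isTableau_cons] at hL
  obtain ⟨hji, hlk, hR⟩ := hL
  by_cases hjl : j = 0 ∧ l = 0
  · obtain ⟨rfl, rfl⟩ := hjl
    simpa [add_assoc] using minorProd_exchange_tops_sub_mem (F := F) hji hlk hji hlk hR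
  have hcomm : minor F i j * minor F k l - minor F k l * minor F i j ∈ pluckerLIdeal F := by
    rcases Nat.eq_zero_or_pos j with rfl | hj
    · rw [← neg_sub]
      exact neg_mem (minor_mul_sub_minor_mul_mem (by lia) (by lia))
    · exact minor_mul_sub_minor_mul_mem (by lia) hj
  have h := mul_mem_lIdeal_right (minorProd F R) hcomm
  simp only [minorProd_cons]
  rw [← mul_assoc, ← mul_assoc, ← sub_mul]
  exact pluckerLIdeal_le_lowerTerms _ h

theorem minorProd_sub_mem_of_perm {L L' : List (ℕ × ℕ)} (h : L.Perm L') (hL : IsTableau L) :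
    minorProd F L - minorProd F L' ∈ lowerTerms F (topSum L) := by
  induction h with
  | nil => simp
  | @cons p L L' _ ih =>
    rw [isTableau_cons] at hL
    rw [minorProd_cons, minorProd_cons, topSum_cons, ← mul_sub]
    exact minor_mul_mem_lowerTerms_of_lt hL.1 (ih hL.2)
  | swap p q R => exact minorProd_swap_sub_mem hL
  | @trans L L' L'' h _ ih ih' =>
    have hsum : topSum L = topSum L' := (h.map Prod.fst).sum_eq
    rw [← sub_add_sub_cancel _ (minorProd F L')]
    exact add_mem (ih hL) (hsum ▸ ih' (hL.perm h))

/-- The equivalence of tableaux that have the same entries in each row. -/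
def SameRows (L L' : List (ℕ × ℕ)) : Prop :=
  (L.map Prod.fst).Perm (L'.map Prod.fst) ∧ (L.map Prod.snd).Perm (L'.map Prod.snd)

theorem SameRows.symm {L L' : List (ℕ × ℕ)} (h : SameRows L L') : SameRows L' L :=
  ⟨h.1.symm, h.2.symm⟩

theorem SameRows.trans {L L' L'' : List (ℕ × ℕ)} (h : SameRows L L') (h' : SameRows L' L'') :
    SameRows L L'' := ⟨h.1.trans h'.1, h.2.trans h'.2⟩

theorem SameRows.topSum_eq {L L' : List (ℕ × ℕ)} (h : SameRows L L') : topSum L = topSum L' :=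
  h.1.sum_eq

theorem SameRows.of_perm {L L' : List (ℕ × ℕ)} (h : L.Perm L') : SameRows L L' :=
  ⟨h.map _, h.map _⟩

theorem SameRows.of_cons {p : ℕ × ℕ} {L L' : List (ℕ × ℕ)} (h : SameRows (p :: L) (p :: L')) :
    SameRows L L' := ⟨h.1.cons_inv, h.2.cons_inv⟩

-- Since `j` is the largest bottom entry, both columns stay strictly decreasing in the exchange.
theorem exists_sameRows_cons_sub_mem {i j : ℕ} {L : List (ℕ × ℕ)} (hL : IsTableau L) (hji : j < i)
    (hi : i ∈ L.map Prod.fst) (hj : j ∈ L.map Prod.snd) (hmax : ∀ l ∈ L.map Prod.snd, l ≤ j) :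
    ∃ R, IsTableau R ∧ SameRows L ((i, j) :: R) ∧
      minorProd F L - minorProd F ((i, j) :: R) ∈ lowerTerms F (topSum L) := by
  obtain ⟨⟨k, j⟩, hkj, rfl⟩ := List.mem_map.1 hj
  have perm₁ := List.perm_cons_erase hkj
  obtain ⟨hjk, hL₁⟩ := isTableau_cons.1 (hL.perm perm₁)
  rcases List.mem_cons.1 ((perm₁.map Prod.fst).mem_iff.1 hi) with rfl | hi₁
  · exact ⟨_, hL₁, .of_perm perm₁, minorProd_sub_mem_of_perm perm₁ hL⟩
  obtain ⟨⟨i, l⟩, hil, rfl⟩ := List.mem_map.1 hi₁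
  have perm₂ := perm₁.trans ((List.perm_cons_erase hil).cons _)
  generalize (L.erase (k, j)).erase (i, l) = R at perm₂
  obtain ⟨-, hli, hR⟩ := by simpa using hL.perm perm₂
  have hlj : l ≤ j := hmax l ((perm₂.map Prod.snd).mem_iff.2 (by simp))
  have hlk : l < k := hlj.trans_lt hjk
  have hrows := SameRows.of_perm perm₂
  refine ⟨(k, l) :: R, isTableau_cons.2 ⟨hlk, hR⟩, ⟨hrows.1.trans (.swap ..), hrows.2⟩, ?_⟩
  rw [← sub_add_sub_cancel _ (minorProd F ((k, j) :: (i, l) :: R))]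
  refine add_mem (minorProd_sub_mem_of_perm perm₂ hL) ?_
  simpa [hrows.topSum_eq, add_assoc] using
    minorProd_exchange_tops_sub_mem (F := F) hjk hji hlk hli hR

theorem minorProd_sub_mem_of_sameRows {L L' : List (ℕ × ℕ)} (hL : IsTableau L)
    (hL' : IsTableau L') (h : SameRows L L') :
    minorProd F L - minorProd F L' ∈ lowerTerms F (topSum L) := by
  induction hn : L.length generalizing L L' with
  | zero =>
    obtain rfl := List.eq_nil_of_length_eq_zero hn
    obtain rfl : L' = [] := by simpa using h.1
    simp
  | succ n ih =>
    obtain ⟨⟨i, j⟩, hij, hmax⟩ := L.toFinset.exists_max_image Prod.snd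
      (List.toFinset_nonempty_iff L |>.2 (List.ne_nil_of_length_eq_add_one hn))
    rw [List.mem_toFinset] at hij
    have perm := List.perm_cons_erase hij
    obtain ⟨hji, hL₁⟩ := isTableau_cons.1 (hL.perm perm)
    obtain ⟨R, hR, hrows, hmem⟩ := exists_sameRows_cons_sub_mem (F := F) hL' hji
      (h.1.mem_iff.1 (List.mem_map_of_mem hij)) (h.2.mem_iff.1 (List.mem_map_of_mem hij)) (by
        intro l hl
        obtain ⟨p, hp, rfl⟩ := List.mem_map.1 (h.2.mem_iff.2 hl)
        exact hmax p (List.mem_toFinset.2 hp))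
    have hrows₁ := (SameRows.of_perm perm).symm.trans (h.trans hrows)
    have htail := minor_mul_mem_lowerTerms_of_lt hji
      (ih hL₁ hR hrows₁.of_cons (by simp [List.length_erase_of_mem hij, hn]))
    rw [mul_sub, ← minorProd_cons (i, j), ← minorProd_cons (i, j), ← topSum_cons (i, j),
      ← (SameRows.of_perm perm).topSum_eq] at htail
    rw [← h.topSum_eq] at hmem
    convert sub_mem (add_mem (minorProd_sub_mem_of_perm perm hL) htail) hmem using 1
    abel

theorem exists_mem_lowerTerms (f : FreeAlg F) : ∃ n, f ∈ lowerTerms F n := by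
  have hspan : f ∈ Submodule.span F (Submonoid.closure (Set.range (x F)) : Set (FreeAlg F)) := by
    rw [← Algebra.adjoin_eq_span F (Set.range (x F)), Subalgebra.mem_toSubmodule,
      show Algebra.adjoin F (Set.range (x F)) = ⊤ from FreeAlgebra.adjoin_range_ι F ℕ]
    exact Algebra.mem_top
  induction hspan using Submodule.span_induction with
  | zero => exact ⟨0, zero_mem _⟩
  | add f g _ _ hf hg =>
    obtain ⟨m, hf⟩ := hf
    obtain ⟨n, hg⟩ := hg
    exact ⟨max m n, add_mem (lowerTerms_mono (le_max_left m n) hf)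
      (lowerTerms_mono (le_max_right m n) hg)⟩
  | smul c f _ hf => exact hf.imp fun n => Submodule.smul_mem _ c
  | mem f hf =>
    induction hf using Submonoid.closure_induction_left with
    | one => exact ⟨1, minorProd_mem_lowerTerms (L := []) (by simp [IsTableau]) (by simp [topSum])⟩
    | mul_left y hy w _ ih =>
      obtain ⟨i, rfl⟩ := hy
      obtain ⟨n, hn⟩ := ih
      exact ⟨_, minor_mul_mem_lowerTerms (i + 1) 0 hn⟩

end Straightening

section GenericSymbol

open MvPolynomial

/-- The polynomial ring in the entries `a i = X (inl i)` and `b j = X (inr j)` of a generic matrix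
with two rows, which has columns indexed as in `minor`. -/
abbrev CoordRing (R : Type*) [CommRing R] := MvPolynomial (ℕ ⊕ ℕ) R

/-- The representation in which the letter `x i` acts as `a (i + 1) b 0 - b (i + 1) ∂/∂(b 0)`. It
comes from the generic element `a (i + 1) y + b (i + 1) x` of the Weyl algebra by letting `y` and
`x` act as `b 0` and `-∂/∂(b 0)`; thus `∂/∂(b 0)` plays the role of `a 0`, and `x i` acts as the
minor of the columns `i + 1` and `0` of the generic matrix. -/
noncomputable def genericRep (F : Type*) [Field F] : FreeAlg F →ₐ[F] Module.End F (CoordRing F) :=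
  FreeAlgebra.lift F fun i =>
    LinearMap.mulLeft F (X (.inl (i + 1)) * X (.inr 0))
      - LinearMap.mulLeft F (X (.inr (i + 1))) * (pderiv (.inr 0)).toLinearMap

/-- The polynomial obtained by letting `f` act on `1` in the generic representation. -/
noncomputable def symbol (F : Type*) [Field F] : FreeAlg F →ₗ[F] CoordRing F :=
  LinearMap.applyₗ (R := F) (1 : CoordRing F) ∘ₗ (genericRep F).toLinearMap

theorem genericRep_x (i : ℕ) (g : CoordRing F) :
    genericRep F (x F i) g
      = X (.inl (i + 1)) * X (.inr 0) * g - X (.inr (i + 1)) * pderiv (.inr 0) g := by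
  simp [genericRep, x, mul_assoc]

theorem genericRep_lie (i j : ℕ) (g : CoordRing F) :
    genericRep F ⁅x F i, x F j⁆ g
      = (X (.inl (i + 1)) * X (.inr (j + 1)) - X (.inl (j + 1)) * X (.inr (i + 1))) * g := by
  have hb (k : ℕ) : pderiv (.inr 0) (X (.inr (k + 1)) : CoordRing F) = 0 :=
    pderiv_X_of_ne (by simp)
  have ha (k : ℕ) : pderiv (.inr 0) (X (.inl k) : CoordRing F) = 0 := pderiv_X_of_ne (by simp)
  simp only [Ring.lie_def, map_sub, map_mul, LinearMap.sub_apply, Module.End.mul_apply,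
    genericRep_x, pderiv_mul, pderiv_X_self, ha, hb]
  ring

theorem symbol_mul (f g : FreeAlg F) : symbol F (f * g) = genericRep F f (symbol F g) := by
  simp [symbol]

theorem symbol_one : symbol F 1 = 1 := by simp [symbol]

end GenericSymbol

section SymbolOfWeakIdentity

variable {R : Type*} [CommRing R]

/-- The representation of the Weyl algebra on `F[t]` in which `y` acts as multiplication by `t` and
`x` as `-d/dt`. -/
noncomputable def weylRep (F : Type*) [Field F] : WeylAlgebra F →ₐ[F] Module.End F (Polynomial F) :=
  RingQuot.liftAlgHom F
    ⟨FreeAlgebra.lift F ![-Polynomial.derivative, LinearMap.mulLeft F Polynomial.X], by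
      rintro _ _ ⟨⟩
      refine LinearMap.ext fun p => ?_
      simp [add_comm]⟩

theorem weylRep_weylX (p : Polynomial F) :
    weylRep F (weylX F) p = -Polynomial.derivative p := by simp [weylRep, weylX]

theorem weylRep_weylY (p : Polynomial F) : weylRep F (weylY F) p = Polynomial.X * p := by
  simp [weylRep, weylY]

/-- The specialization of all coordinates other than `b 0` to the values given by `e`. -/
noncomputable def specialize (e : ℕ ⊕ ℕ → R) : CoordRing R →ₐ[R] Polynomial R :=
  MvPolynomial.aeval (Function.update (fun s => Polynomial.C (e s)) (.inr 0) Polynomial.X)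

theorem specialize_X_of_ne (e : ℕ ⊕ ℕ → R) {s : ℕ ⊕ ℕ} (hs : s ≠ .inr 0) :
    specialize e (MvPolynomial.X s) = Polynomial.C (e s) := by
  simp [specialize, hs]

theorem specialize_X_inr_zero (e : ℕ ⊕ ℕ → R) :
    specialize e (MvPolynomial.X (.inr 0)) = Polynomial.X := by
  simp [specialize]

theorem eval_specialize (e : ℕ ⊕ ℕ → R) (g : CoordRing R) :
    (specialize e g).eval (e (.inr 0)) = MvPolynomial.eval e g := by
  induction g using MvPolynomial.induction_on with
  | C c => simp [specialize]
  | add g h hg hh => simp [hg, hh]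
  | mul_X g s hg =>
    rcases eq_or_ne s (.inr 0) with rfl | hs
    · simp [hg, specialize_X_inr_zero]
    · simp [hg, specialize_X_of_ne e hs]

theorem specialize_pderiv (e : ℕ ⊕ ℕ → R) (g : CoordRing R) :
    specialize e (MvPolynomial.pderiv (.inr 0) g) = Polynomial.derivative (specialize e g) := by
  induction g using MvPolynomial.induction_on with
  | C c => simp [specialize]
  | add g h hg hh => simp [hg, hh]
  | mul_X g s hg =>
    rcases eq_or_ne s (.inr 0) with rfl | hs
    · simp only [MvPolynomial.pderiv_mul, MvPolynomial.pderiv_X_self, map_add, map_mul, map_one,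
        specialize_X_inr_zero, hg, Polynomial.derivative_mul, Polynomial.derivative_X]
    · rw [MvPolynomial.pderiv_mul, MvPolynomial.pderiv_X_of_ne hs]
      simp [hg, specialize_X_of_ne e hs]

theorem specialize_genericRep (e : ℕ ⊕ ℕ → F) (f : FreeAlg F) (g : CoordRing F) :
    specialize e (genericRep F f g)
      = weylRep F (subst (fun i => e (.inr (i + 1)) • weylX F + e (.inl (i + 1)) • weylY F) f)
          (specialize e g) := by
  rw [subst]
  induction f using FreeAlgebra.induction generalizing g with
  | grade0 c => simp
  | grade1 i =>
    rw [← x, genericRep_x]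
    have ha : specialize e (MvPolynomial.X (.inl (i + 1))) = Polynomial.C (e (.inl (i + 1))) :=
      specialize_X_of_ne e (by simp)
    have hb : specialize e (MvPolynomial.X (.inr (i + 1))) = Polynomial.C (e (.inr (i + 1))) :=
      specialize_X_of_ne e (by simp)
    simp only [map_sub, map_mul, ha, hb, specialize_X_inr_zero, specialize_pderiv, x,
      FreeAlgebra.lift_ι_apply, map_add, map_smul, LinearMap.add_apply, LinearMap.smul_apply,
      weylRep_weylX, weylRep_weylY, smul_neg, Polynomial.smul_eq_C_mul]
    ring
  | mul f f' hf hf' => simp [hf, hf']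
  | add f f' hf hf' => simp [hf, hf']

theorem symbol_eq_zero_of_isWeakIdentity [Infinite F] {f : FreeAlg F}
    (hf : IsWeakIdentity (weylV F) f) : symbol F f = 0 := by
  refine MvPolynomial.funext fun e => ?_
  have hsubst := hf (fun i => e (.inr (i + 1)) • weylX F + e (.inl (i + 1)) • weylY F) fun i =>
    Submodule.mem_span_pair.2 ⟨_, _, rfl⟩
  change MvPolynomial.eval e (genericRep F f 1) = _
  rw [← eval_specialize, specialize_genericRep, hsubst]
  simp

end SymbolOfWeakIdentity

section LeadingTerms

open MvPolynomial

variable {R : Type*} [CommRing R]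

/-- The weight of an exponent, for which `a i` has weight `i` and every `b j` has weight `0`. -/
noncomputable def expWeight : (ℕ ⊕ ℕ →₀ ℕ) →+ ℕ := Finsupp.weight (Sum.elim id 0)

/-- The span of the monomials of weight less than `n`. -/
noncomputable def lowerPolys (R : Type*) [CommRing R] (n : ℕ) : Submodule R (CoordRing R) :=
  restrictSupport R {s | expWeight s < n}

/-- The exponent of the leading monomial `a i * b j` of the minor `[i|j]`, for `j < i`. -/
noncomputable def colExp (p : ℕ × ℕ) : ℕ ⊕ ℕ →₀ ℕ := .single (.inl p.1) 1 + .single (.inr p.2) 1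

/-- The exponent of the leading monomial of the product of minors given by a tableau. -/
noncomputable def tableauExp (L : List (ℕ × ℕ)) : ℕ ⊕ ℕ →₀ ℕ := (L.map colExp).sum

theorem tableauExp_cons (p : ℕ × ℕ) (L : List (ℕ × ℕ)) :
    tableauExp (p :: L) = colExp p + tableauExp L := by simp [tableauExp]

@[simp]
theorem expWeight_single_inl (i c : ℕ) : expWeight (.single (.inl i) c) = c * i := by
  simp [expWeight, Finsupp.weight_single]

@[simp]
theorem expWeight_single_inr (j c : ℕ) : expWeight (.single (.inr j) c) = 0 := by
  simp [expWeight, Finsupp.weight_single]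

theorem expWeight_tsub_le (s t : ℕ ⊕ ℕ →₀ ℕ) : expWeight (s - t) ≤ expWeight s := by
  obtain ⟨u, hu⟩ := exists_add_of_le (tsub_le_self : s - t ≤ s)
  calc expWeight (s - t) ≤ expWeight (s - t) + expWeight u := Nat.le_add_right _ _
    _ = expWeight s := by rw [← map_add, ← hu]

theorem expWeight_tableauExp (L : List (ℕ × ℕ)) : expWeight (tableauExp L) = topSum L := by
  simp [tableauExp, topSum, map_list_sum, List.map_map, Function.comp_def, colExp]

theorem sameRows_of_tableauExp_eq {L L' : List (ℕ × ℕ)} (h : tableauExp L = tableauExp L') :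
    SameRows L L' := by
  have hcount (L : List (ℕ × ℕ)) (i : ℕ) : tableauExp L (.inl i) = (L.map Prod.fst).count i ∧
      tableauExp L (.inr i) = (L.map Prod.snd).count i := by
    induction L with
    | nil => simp [tableauExp]
    | cons p L ih =>
      simp [ih, tableauExp_cons, colExp, List.count_cons, Finsupp.single_apply, add_comm]
  exact ⟨List.perm_iff_count.2 fun i => by rw [← (hcount L i).1, h, (hcount L' i).1],
    List.perm_iff_count.2 fun i => by rw [← (hcount L i).2, h, (hcount L' i).2]⟩

theorem monomial_mem_lowerPolys {s : ℕ ⊕ ℕ →₀ ℕ} {n : ℕ} (h : expWeight s < n) (c : R) :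
    monomial s c ∈ lowerPolys R n := (monomial_mem_restrictSupport R).2 (.inl h)

theorem lowerPolys_mono : Monotone (lowerPolys R) := fun _ _ h =>
  restrictSupport_mono R fun _ hs => lt_of_lt_of_le hs h

theorem lowerPolys_le {n : ℕ} {P : Submodule R (CoordRing R)}
    (h : ∀ s, expWeight s < n → monomial s 1 ∈ P) : lowerPolys R n ≤ P := by
  rw [lowerPolys, restrictSupport_eq_span, Submodule.span_le]
  rintro _ ⟨s, hs, rfl⟩
  exact h s hs

theorem genericRep_minor_monomial_sub_mem {i j : ℕ} (hji : j < i) (s : ℕ ⊕ ℕ →₀ ℕ) :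
    genericRep F (minor F i j) (monomial s 1) - monomial (colExp (i, j) + s) 1
      ∈ lowerPolys F (i + expWeight s) := by
  obtain ⟨i, rfl⟩ := Nat.exists_eq_succ_of_ne_zero (Nat.ne_zero_of_lt hji)
  cases j with
  | zero =>
    rw [minor, genericRep_x, pderiv_monomial]
    simp only [X, monomial_mul, colExp, one_mul, sub_sub_cancel_left]
    refine neg_mem (monomial_mem_lowerPolys ?_ _)
    rw [map_add, expWeight_single_inr]
    have := expWeight_tsub_le s (.single (.inr 0) 1)
    lia
  | succ j =>
    rw [minor, genericRep_lie, sub_mul]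
    simp only [X, monomial_mul, colExp, one_mul, sub_sub_cancel_left]
    refine neg_mem (monomial_mem_lowerPolys ?_ _)
    simp only [map_add, expWeight_single_inl, expWeight_single_inr]
    lia

theorem genericRep_minor_mem_lowerPolys {i j n : ℕ} (hji : j < i) {g : CoordRing F}
    (hg : g ∈ lowerPolys F n) : genericRep F (minor F i j) g ∈ lowerPolys F (i + n) := by
  suffices hle : lowerPolys F n ≤
      (lowerPolys F (i + n)).comap (genericRep F (minor F i j)) from hle hg
  refine lowerPolys_le fun s hs => ?_
  rw [Submodule.mem_comap, ← sub_add_cancel (genericRep F (minor F i j) _)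
    (monomial (colExp (i, j) + s) 1)]
  refine add_mem (lowerPolys_mono (by lia) (genericRep_minor_monomial_sub_mem hji s))
    (monomial_mem_lowerPolys ?_ _)
  simpa [colExp] using hs

theorem symbol_minorProd_sub_mem {L : List (ℕ × ℕ)} (hL : IsTableau L) :
    symbol F (minorProd F L) - monomial (tableauExp L) 1 ∈ lowerPolys F (topSum L) := by
  induction L with
  | nil => simp [minorProd, tableauExp, symbol_one]
  | cons p L ih =>
    obtain ⟨hp, hL⟩ := isTableau_cons.1 hL
    have htail := genericRep_minor_mem_lowerPolys hp (ih hL)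
    have hhead := genericRep_minor_monomial_sub_mem (F := F) hp (tableauExp L)
    rw [expWeight_tableauExp] at hhead
    rw [map_sub] at htail
    rw [minorProd_cons, symbol_mul, topSum_cons, tableauExp_cons]
    simpa using add_mem htail hhead

end LeadingTerms

section Injectivity

open MvPolynomial

open Classical in
/-- A product of minors with leading exponent `s`, or `0` if there is none. -/
noncomputable def minorProdOfExp (F : Type*) [Field F] (s : ℕ ⊕ ℕ →₀ ℕ) : FreeAlg F :=
  if h : ∃ L, IsTableau L ∧ tableauExp L = s then minorProd F h.choose else 0

/-- The linear lift `CoordRing F → FreeAlg F` of leading monomials to products of minors. -/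
noncomputable def liftLeading (F : Type*) [Field F] : CoordRing F →ₗ[F] FreeAlg F :=
  (basisMonomials (ℕ ⊕ ℕ) F).constr F (minorProdOfExp F)

theorem liftLeading_monomial (s : ℕ ⊕ ℕ →₀ ℕ) :
    liftLeading F (monomial s 1) = minorProdOfExp F s := by
  simpa [liftLeading] using (basisMonomials (ℕ ⊕ ℕ) F).constr_basis F (minorProdOfExp F) s

theorem minorProdOfExp_mem_lowerTerms {s : ℕ ⊕ ℕ →₀ ℕ} {n : ℕ} (hs : expWeight s < n) :
    minorProdOfExp F s ∈ lowerTerms F n := by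
  rw [minorProdOfExp]
  split_ifs with h
  · refine minorProd_mem_lowerTerms h.choose_spec.1 ?_
    rwa [← expWeight_tableauExp, h.choose_spec.2]
  · exact zero_mem _

theorem minorProd_sub_minorProdOfExp_mem {L : List (ℕ × ℕ)} (hL : IsTableau L) :
    minorProd F L - minorProdOfExp F (tableauExp L) ∈ lowerTerms F (topSum L) := by
  have h : ∃ L', IsTableau L' ∧ tableauExp L' = tableauExp L := ⟨L, hL, rfl⟩
  rw [minorProdOfExp, dif_pos h]
  exact minorProd_sub_mem_of_sameRows hL h.choose_spec.1
    (sameRows_of_tableauExp_eq h.choose_spec.2.symm)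

theorem liftLeading_mem_lowerTerms {n : ℕ} {g : CoordRing F} (hg : g ∈ lowerPolys F n) :
    liftLeading F g ∈ lowerTerms F n := by
  suffices hle : lowerPolys F n ≤ (lowerTerms F n).comap (liftLeading F) from hle hg
  refine lowerPolys_le fun s hs => ?_
  rw [Submodule.mem_comap, liftLeading_monomial]
  exact minorProdOfExp_mem_lowerTerms hs

theorem isWeakIdentity_of_mem_pluckerLIdeal {f : FreeAlg F} (hf : f ∈ pluckerLIdeal F) :
    IsWeakIdentity (weylV F) f :=
  isWeakIdentity_of_mem_lIdeal (fun _ => isWeakIdentity_of_weyl weylY_mul_weylX) hf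

variable [Infinite F]

theorem sub_liftLeading_symbol_mem {n : ℕ} {f : FreeAlg F} (hf : f ∈ lowerTerms F (n + 1)) :
    f - liftLeading F (symbol F f) ∈ lowerTerms F n := by
  suffices hle : lowerTerms F (n + 1) ≤
      (lowerTerms F n).comap (LinearMap.id - liftLeading F ∘ₗ symbol F) from hle hf
  refine lowerTerms_le (fun g hg => ?_) fun L hL hn => ?_
  · have hsymbol := symbol_eq_zero_of_isWeakIdentity (isWeakIdentity_of_mem_pluckerLIdeal hg)
    simpa [hsymbol] using pluckerLIdeal_le_lowerTerms n hg
  · have htail := liftLeading_mem_lowerTerms (symbol_minorProd_sub_mem (F := F) hL)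
    rw [map_sub, liftLeading_monomial] at htail
    refine lowerTerms_mono (Nat.lt_succ_iff.1 hn) ?_
    simpa using sub_mem (minorProd_sub_minorProdOfExp_mem hL) htail

theorem mem_pluckerLIdeal_of_symbol_eq_zero {f : FreeAlg F} (hf : symbol F f = 0) :
    f ∈ pluckerLIdeal F := by
  obtain ⟨n, hn⟩ := exists_mem_lowerTerms f
  induction n with
  | zero => rwa [← lowerTerms_zero]
  | succ n ih => exact ih (by simpa [hf] using sub_liftLeading_symbol_mem hn)

end Injectivity

end WeakPI

theorem mainTheorem3_general (F : Type*) [Field F] [Infinite F] (f : WeakPI.FreeAlg F) :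
    WeakPI.IsWeakIdentity (WeakPI.weylV F) f ↔
      f ∈ WeakPI.lIdeal {WeakPI.Gamma3 F, WeakPI.St3 F, WeakPI.T4 F} :=
  ⟨fun hf => WeakPI.mem_pluckerLIdeal_of_symbol_eq_zero
    (WeakPI.symbol_eq_zero_of_isWeakIdentity hf), WeakPI.isWeakIdentity_of_mem_pluckerLIdeal⟩

theorem mainTheorem3 (F : Type*) [Field F] [Infinite F] (f : WeakPI.FreeAlg F)
    (hf : WeakPI.IsWeakIdentity (WeakPI.weylV F) f) (hdeg : WeakPI.degree f = 4) :
    f ∈ WeakPI.lIdeal {WeakPI.Gamma3 F, WeakPI.St3 F, WeakPI.T4 F} :=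
  (mainTheorem3_general F f).1 hf
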